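/- Let $n, C$ be natural numbers, let $\mathrm{Sym}_n$ be the space of real symmetric $n\times n$ matrices with the Frobenius inner product $\langle V,W\rangle=\operatorname{tr}(V^{\top}W)$, and let $\mathcal S^n_{++}\subset\mathrm{Sym}_n$ be the open set of symmetric positive definite (SPD) matrices. Fix $\theta>0$. The Power-Euclidean metric (PEM) on $\mathcal S^n_{++}$ is $g_P(V,W)=\frac1{\theta^2}\langle D\mathrm{Pow}_\theta(P)[V],\,D\mathrm{Pow}_\theta(P)[W]\rangle$, where $\mathrm{Pow}_\theta(P)=P^\theta$ is the matrix power. Put $\phi_\theta(S)=\frac1\theta S^\theta$. The PEM-based SPD multinomial logistic regression (MLR), with parameters $P_k\in\mathcal S^n_{++}$ and $A_k\in\mathrm{Sym}_n$ ($1\le k\le C$), assigns to $S\in\mathcal S^n_{++}$ the class probabilities $$p(y=k\mid S)\propto\exp\Big[\tfrac1\theta\langle S^\theta-P_k^\theta,A_k\rangle\Big].$$ The Euclidean MLR in the codomain of $\phi_\theta$, with parameters $p_k,a_k\in\mathrm{Sym}_n$, assigns to $S$ the class probabilities $$p(y=k\mid S)\propto\exp\big[\langle a_k,\phi_\theta(S)-p_k\rangle\big].$$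 Both models are trained with the same data: in step $t=0,1,2,\dots$ there is a finite mini-batch of SPD inputs, a loss $\ell_t$ which is a function of the class probabilities on the batch, differentiable where all of them are positive, and learning rates $\gamma_t,\eta_t\in\mathbb R$; $L_t$ denotes the resulting loss as a function of the parameters of the model. In the SPD MLR, $$P_k^{t+1}=\mathrm{Exp}_{P_k^t}\big(-\gamma_t\operatorname{grad}_{P_k}L_t\big),\qquad A_k^{t+1}=A_k^t-\eta_t\nabla_{A_k}L_t,$$ where $\operatorname{grad}$ and $\mathrm{Exp}$ are the Riemannian gradient and exponential map of PEM; the step in $P_k$ is defined only if the geodesic in question exists in $\mathcal S^n_{++}$ up to time $1$. In the Euclidean MLR, $$p_k^{t+1}=p_k^t-\gamma_t\nabla_{p_k}L_t,\qquad a_k^{t+1}=a_k^t-\eta_t\nabla_{a_k}L_t.$$ All gradients of step $t$ are taken at the parameters of step $t$. Then $\phi_\theta$ is a bijection of $\mathcal S^n_{++}$ onto itself, and training the two models is equivalent, for any finite or infinite number $T$ of steps: (1) If $(P^t,A^t)$ is a training run of $T$ steps of the SPD MLR starting in $P_k^0\in\mathcal S^n_{++}$, and $(p^t,a^t)$ is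 the training run of the Euclidean MLR with $p_k^0=\phi_\theta(P_k^0)$ and $a_k^0=A_k^0$, then for all $t\le T$ and all $k$ one has $P_k^t\in\mathcal S^n_{++}$, $p_k^t=\phi_\theta(P_k^t)$ and $a_k^t=A_k^t$, and both models assign the same class probabilities to every $S\in\mathcal S^n_{++}$. (2) Conversely, if $(p^t,a^t)$ is a training run of $T$ steps of the Euclidean MLR with $p_k^t\in\mathcal S^n_{++}$ for all $t\le T$ and all $k$, then there is a training run $(P^t,A^t)$ of $T$ steps of the SPD MLR with $p_k^t=\phi_\theta(P_k^t)$ and $a_k^t=A_k^t$ for all $t\le T$ and all $k$. -/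

import Mathlib

open Set

/-! ### Symmetric and symmetric positive definite matrices -/

/-- The real symmetric matrices as a subspace of the space of all matrices. -/
def symSubmodule (n : ℕ) : Submodule ℝ (Matrix (Fin n) (Fin n) ℝ) where
  carrier := {A | A.IsSymm}
  add_mem' hA hB := hA.add hB
  zero_mem' := Matrix.isSymm_zero
  smul_mem' c _ hA := hA.smul c

/-- The space of real symmetric `n × n` matrices. It carries the Frobenius inner
product defined below, and the norm and the topology given by it. -/
def SymMat (n : ℕ) : Type := symSubmodule n

instance (n : ℕ) : AddCommGroup (SymMat n) := inferInstanceAs (AddCommGroup (symSubmodule n))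

instance (n : ℕ) : Module ℝ (SymMat n) := inferInstanceAs (Module ℝ (symSubmodule n))

instance (n : ℕ) : FiniteDimensional ℝ (SymMat n) :=
  inferInstanceAs (FiniteDimensional ℝ (symSubmodule n))

/-- The inclusion of the symmetric matrices into all matrices. -/
def SymMat.toMatrix {n : ℕ} : SymMat n →ₗ[ℝ] Matrix (Fin n) (Fin n) ℝ := (symSubmodule n).subtype

theorem SymMat.toMatrix_injective {n : ℕ} : Function.Injective (SymMat.toMatrix (n := n)) :=
  Subtype.val_injective

theorem SymMat.isSymm {n : ℕ} (A : SymMat n) : A.toMatrix.IsSymm := A.2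

theorem SymMat.isHermitian {n : ℕ} (A : SymMat n) : A.toMatrix.IsHermitian := by
  rw [Matrix.IsHermitian, Matrix.conjTranspose_eq_transpose_of_trivial, A.isSymm]

/-- The Frobenius inner product `⟨A, B⟩ = tr (Aᵀ B)`. -/
noncomputable abbrev SymMat.innerCore (n : ℕ) : InnerProductSpace.Core ℝ (SymMat n) where
  inner A B := (A.toMatrix.transpose * B.toMatrix).trace
  conj_inner_symm A B := by
    simp only [conj_trivial]
    rw [← Matrix.trace_transpose, Matrix.transpose_mul, Matrix.transpose_transpose]
  re_inner_nonneg A := by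
    simp only [Matrix.trace, Matrix.diag, Matrix.mul_apply, Matrix.transpose_apply,
      RCLike.re_to_real]
    exact Finset.sum_nonneg fun i _ => Finset.sum_nonneg fun j _ => mul_self_nonneg _
  add_left A B D := by simp [add_mul]
  smul_left A B r := by simp
  definite A h := by
    apply SymMat.toMatrix_injective
    rw [map_zero]
    rwa [← Matrix.conjTranspose_eq_transpose_of_trivial,
      Matrix.trace_conjTranspose_mul_self_eq_zero_iff] at h

noncomputable instance (n : ℕ) : NormedAddCommGroup (SymMat n) :=
  (SymMat.innerCore n).toNormedAddCommGroup

noncomputable instance (n : ℕ) : InnerProductSpace ℝ (SymMat n) :=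
  InnerProductSpace.ofCore (SymMat.innerCore n).toCore

instance (n : ℕ) : CompleteSpace (SymMat n) := FiniteDimensional.complete ℝ (SymMat n)

/-- The set of symmetric positive definite matrices, an open subset of `SymMat n`. -/
def SPD (n : ℕ) : Set (SymMat n) := {P | P.toMatrix.PosDef}

/-- The matrix power `A ^ θ`: the power is applied to the eigenvalues in an orthogonal
eigendecomposition. It is only used for positive definite `A`. -/
noncomputable def symPow {n : ℕ} (θ : ℝ) (A : SymMat n) : SymMat n :=
  ⟨A.isHermitian.cfc (fun x : ℝ => x ^ θ), by
    have h : IsSelfAdjoint (A.isHermitian.cfc (fun x : ℝ => x ^ θ)) := by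
      rw [← Matrix.IsHermitian.cfc_eq]
      exact cfc_predicate _ _
    have h' : (A.isHermitian.cfc (fun x : ℝ => x ^ θ)).conjTranspose
        = A.isHermitian.cfc (fun x : ℝ => x ^ θ) := h
    rwa [Matrix.conjTranspose_eq_transpose_of_trivial] at h'⟩

/-- The map `φ_θ (S) = (1 / θ) S ^ θ`. -/
noncomputable def scaledPow {n : ℕ} (θ : ℝ) (S : SymMat n) : SymMat n :=
  (1 / θ) • symPow θ S

/-! ### Riemannian metrics on open subsets of a vector space

The open set `U ⊆ E` is covered by a single chart, its tangent spaces are all identified with `E`,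
and a Riemannian metric is a map `g` with `g x v w = ⟨v, w⟩_x`. -/

/-- A geodesic `c : [0, 1] → U` of the metric `g`: a `C²` curve in `U` that satisfies the geodesic
equation `∇_{c'} c' = 0` of the Levi-Civita connection of `g`. The equation is paired with
an arbitrary vector `w`, using the Koszul formula
`g_x(Γ_x(v, v), w) = (∂_v g)_x(v, w) - ½ (∂_w g)_x(v, v)` for the Christoffel symbol `Γ`. -/
def IsRiemGeodesic {E : Type*} [NormedAddCommGroup E] [NormedSpace ℝ E]
    (g : E → E → E → ℝ) (U : Set E) (c : ℝ → E) : Prop :=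
  ContDiffOn ℝ 2 c (Icc 0 1) ∧
  ∀ t ∈ Icc (0 : ℝ) 1, c t ∈ U ∧
    let v : E := derivWithin c (Icc 0 1) t
    let b : E := derivWithin (derivWithin c (Icc 0 1)) (Icc 0 1) t
    ∀ w : E, g (c t) b w + fderiv ℝ (fun x => g x v w) (c t) v
      - (1 / 2) * fderiv ℝ (fun x => g x v v) (c t) w = 0

/-- `Exp_x (v) = y` for the Riemannian exponential map of `(U, g)`: the geodesic with
initial point `x` and initial velocity `v` exists in `U` up to time `1`, where it reaches `y`. -/
def IsRiemExp {E : Type*} [NormedAddCommGroup E] [NormedSpace ℝ E]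
    (g : E → E → E → ℝ) (U : Set E) (x v y : E) : Prop :=
  ∃ c : ℝ → E, IsRiemGeodesic g U c ∧ c 0 = x ∧ derivWithin c (Icc 0 1) 0 = v ∧ c 1 = y

/-- `G` is the Riemannian gradient at `x` of the function `f`, differentiable at `x`. -/
def IsRiemGradient {E : Type*} [NormedAddCommGroup E] [NormedSpace ℝ E]
    (g : E → E → E → ℝ) (f : E → ℝ) (x G : E) : Prop :=
  DifferentiableAt ℝ f x ∧ ∀ v : E, g x G v = fderiv ℝ f x v

/-- A step of Riemannian (stochastic) gradient descent for `f` with learning rate `γ`: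
`y = Exp_x (- γ grad f (x))`. -/
def IsRSGDStep {E : Type*} [NormedAddCommGroup E] [NormedSpace ℝ E]
    (g : E → E → E → ℝ) (U : Set E) (γ : ℝ) (f : E → ℝ) (x y : E) : Prop :=
  ∃ G : E, IsRiemGradient g f x G ∧ IsRiemExp g U x (-(γ • G)) y

/-- The result of a step of Euclidean (stochastic) gradient descent for `f` with learning
rate `γ`. -/
noncomputable def sgdStep {E : Type*} [NormedAddCommGroup E] [InnerProductSpace ℝ E]
    [CompleteSpace E] (γ : ℝ) (f : E → ℝ) (x : E) : E :=
  x - γ • gradient f x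

/-- The Power-Euclidean metric on `SPD n`: the pullback of the Frobenius inner product by
the matrix power, divided by `θ²`. -/
noncomputable def pemMetric {n : ℕ} (θ : ℝ) (P V W : SymMat n) : ℝ :=
  (1 / θ ^ 2) * inner ℝ (fderiv ℝ (symPow θ) P V) (fderiv ℝ (symPow θ) P W)

/-! ### Multinomial logistic regressions and their training -/

/-- The probability vector proportional to `exp (z k)`. -/
noncomputable def softmaxProb {C : ℕ} (z : Fin C → ℝ) (k : Fin C) : ℝ :=
  Real.exp (z k) / ∑ j, Real.exp (z j)

/-- The class probabilities of the Euclidean multinomial logistic regression,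
`p (y = k | x) ∝ exp ⟨a k, x - p k⟩`. -/
noncomputable def euclMLR {E : Type*} [NormedAddCommGroup E] [InnerProductSpace ℝ E] {C : ℕ}
    (p a : Fin C → E) (x : E) : Fin C → ℝ :=
  softmaxProb fun k => inner ℝ (a k) (x - p k)

/-- The class probabilities of the SPD multinomial logistic regression under the Power-Euclidean
metric, `p (y = k | S) ∝ exp ((1 / θ) ⟨S ^ θ - P k ^ θ, A k⟩)`. -/
noncomputable def pemMLR {n C : ℕ} (θ : ℝ) (P A : Fin C → SymMat n) (S : SymMat n) :
    Fin C → ℝ :=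
  softmaxProb fun k => (1 / θ) * inner ℝ (symPow θ S - symPow θ (P k)) (A k)

/-- Training data of one step: a mini-batch of SPD inputs and a loss, which is a
function of the class probabilities that the classifier assigns to the inputs of the batch (labels
are part of this function) and is differentiable where all probabilities are positive. -/
structure SPDBatch (n C : ℕ) where
  size : ℕ
  input : Fin size → SymMat n
  input_mem : ∀ i, input i ∈ SPD n
  loss : (Fin size → Fin C → ℝ) → ℝ
  loss_diff : DifferentiableOn ℝ loss {q | ∀ i k, 0 < q i k}

/-- The loss on a batch of a classifier that assigns class probabilities to SPD matrices. -/
def SPDBatch.eval {n C : ℕ} (B : SPDBatch n C) (clf : SymMat n → Fin C → ℝ) : ℝ :=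
  B.loss fun i => clf (B.input i)

/-- The sequences `P`, `A` are the parameters of the SPD multinomial logistic regression under the
Power-Euclidean metric, trained for `T` steps (`T = ⊤` is allowed): in step `t`, with the
batch `B t`, each `P k` makes an RSGD step for the Power-Euclidean metric and each `A k` a
Euclidean SGD step. -/
def IsPEMTraining {n C : ℕ} (θ : ℝ) (γ η : ℕ → ℝ) (B : ℕ → SPDBatch n C) (T : ℕ∞)
    (P A : ℕ → Fin C → SymMat n) : Prop :=
  (∀ k, P 0 k ∈ SPD n) ∧
  ∀ t : ℕ, (t : ℕ∞) < T → ∀ k,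
    IsRSGDStep (pemMetric θ) (SPD n) (γ t)
      (fun X => (B t).eval (pemMLR θ (Function.update (P t) k X) (A t)))
      (P t k) (P (t + 1) k) ∧
    A (t + 1) k = sgdStep (η t)
      (fun X => (B t).eval (pemMLR θ (P t) (Function.update (A t) k X))) (A t k)

/-- The sequences `p`, `a` are the parameters of the Euclidean multinomial logistic regression on
the symmetric matrices, applied to the transformed inputs `φ S`, and trained by
Euclidean SGD for `T` steps. -/
def IsEuclTraining {n C : ℕ} (φ : SymMat n → SymMat n) (γ η : ℕ → ℝ) (B : ℕ → SPDBatch n C)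
    (T : ℕ∞) (p a : ℕ → Fin C → SymMat n) : Prop :=
  ∀ t : ℕ, (t : ℕ∞) < T → ∀ k,
    p (t + 1) k = sgdStep (γ t)
      (fun X => (B t).eval fun S => euclMLR (Function.update (p t) k X) (a t) (φ S)) (p t k) ∧
    a (t + 1) k = sgdStep (η t)
      (fun X => (B t).eval fun S => euclMLR (p t) (Function.update (a t) k X) (φ S)) (a t k)

/-!
The map `φ_θ = scaledPow θ` is a `C²` diffeomorphism of the convex open cone `SPD n` onto itself, and
the Power-Euclidean metric is the pullback of the Frobenius inner product along it
(`pemMetric_eq_pullbackMetric`). In the chart `φ_θ` every notion of Riemannian optimisation is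
therefore the Euclidean one:

* the geodesic equation of a pullback metric, paired with `w`, reads `⟨(φ ∘ c)'', Dφ w⟩ = 0`
  (`pullbackMetric_geodesic_expression`), so geodesics are the curves whose image under `φ` is affine
  (`IsRiemExp.map_eq_add`, `isRiemExp_pullbackMetric`);
* `Dφ` sends the Riemannian gradient of `h ∘ φ` to the Euclidean gradient of `h`
  (`isRiemGradient_pullbackMetric_iff`).

Hence `φ` carries a Riemannian gradient step for `h ∘ φ` to a Euclidean gradient step for `h`
(`IsRSGDStep.map_eq_sgdStep`). Conversely, if both ends of a Euclidean step lie in the convex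
image `SPD n`, then so does the segment between them, and its preimage is the required geodesic
(`isRSGDStep_pullbackMetric`). Since the class probabilities of the two regressions agree for parameters
that correspond under `φ_θ` (`pemMLR_eq_euclMLR`), the losses correspond as well, and the
training runs correspond by induction on the number of steps.

The analytic input is the smoothness of `A ↦ A ^ θ = exp (θ log A)`. The exponential is smooth on
the symmetric matrices and injective with left inverse `log`, so by the inverse function theorem `log`
is smooth once the derivative of `exp` is known to be injective (`fderiv_symFun_exp_injective`). The
same argument shows that `SPD n`, the range of `exp`, is open. The inverse of `φ_θ` is again built from
a matrix power, so it is smooth too.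
-/

/-! ### Functional calculus on symmetric matrices -/

section FunctionalCalculus

/-- The functional calculus on symmetric matrices: `f` is applied to the eigenvalues in an
orthogonal eigendecomposition. -/
noncomputable def symFun {n : ℕ} (f : ℝ → ℝ) (A : SymMat n) : SymMat n :=
  ⟨A.isHermitian.cfc f, by
    have h : IsSelfAdjoint (A.isHermitian.cfc f) := by
      rw [← Matrix.IsHermitian.cfc_eq]
      exact cfc_predicate _ _
    have h' : (A.isHermitian.cfc f).conjTranspose = A.isHermitian.cfc f := h
    rwa [Matrix.conjTranspose_eq_transpose_of_trivial] at h'⟩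

variable {n : ℕ}

theorem symPow_eq_symFun (θ : ℝ) : symPow (n := n) θ = symFun (fun x => x ^ θ) := rfl

theorem toMatrix_symFun (f : ℝ → ℝ) (A : SymMat n) :
    (symFun f A).toMatrix = cfc f A.toMatrix :=
  (A.isHermitian.cfc_eq f).symm

theorem continuousOn_spectrum (f : ℝ → ℝ) (A : SymMat n) :
    ContinuousOn f (spectrum ℝ A.toMatrix) :=
  (Set.toFinite _).continuousOn f

theorem spectrum_symFun (f : ℝ → ℝ) (A : SymMat n) :
    spectrum ℝ (symFun f A).toMatrix = f '' spectrum ℝ A.toMatrix := by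
  rw [toMatrix_symFun]
  exact cfc_map_spectrum f A.toMatrix A.isHermitian (continuousOn_spectrum f A)

theorem symFun_comp (g f : ℝ → ℝ) (A : SymMat n) :
    symFun g (symFun f A) = symFun (g ∘ f) A := by
  apply SymMat.toMatrix_injective
  rw [toMatrix_symFun, toMatrix_symFun, toMatrix_symFun]
  exact (cfc_comp g f A.toMatrix A.isHermitian ((Set.toFinite _).continuousOn g)
    (continuousOn_spectrum f A)).symm

theorem symFun_congr {f g : ℝ → ℝ} {A : SymMat n} (h : (spectrum ℝ A.toMatrix).EqOn f g) :
    symFun f A = symFun g A := by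
  apply SymMat.toMatrix_injective
  rw [toMatrix_symFun, toMatrix_symFun, cfc_congr h]

theorem symFun_id (A : SymMat n) : symFun id A = A := by
  apply SymMat.toMatrix_injective
  rw [toMatrix_symFun]
  exact cfc_id ℝ A.toMatrix A.isHermitian

theorem symFun_const_mul (r : ℝ) (f : ℝ → ℝ) (A : SymMat n) :
    symFun (fun x => r * f x) A = r • symFun f A := by
  apply SymMat.toMatrix_injective
  rw [toMatrix_symFun, map_smul, toMatrix_symFun]
  exact cfc_const_mul r f A.toMatrix (continuousOn_spectrum f A)

theorem mem_SPD_iff_spectrum {A : SymMat n} :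
    A ∈ SPD n ↔ ∀ x ∈ spectrum ℝ A.toMatrix, 0 < x := by
  change A.toMatrix.PosDef ↔ _
  rw [A.isHermitian.posDef_iff_eigenvalues_pos, A.isHermitian.spectrum_real_eq_range_eigenvalues,
    Set.forall_mem_range]

theorem convex_SPD (n : ℕ) : Convex ℝ (SPD n) := by
  rw [convex_iff_forall_pos]
  intro A hA B hB a b ha hb _
  change (a • A + b • B).toMatrix.PosDef
  rw [map_add, map_smul, map_smul]
  exact (Matrix.PosDef.smul hA ha).add (Matrix.PosDef.smul hB hb)

theorem smul_mem_SPD {c : ℝ} (hc : 0 < c) {A : SymMat n} (hA : A ∈ SPD n) : c • A ∈ SPD n := by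
  change (c • A).toMatrix.PosDef
  rw [map_smul]
  exact Matrix.PosDef.smul hA hc

theorem symFun_mem_SPD {f : ℝ → ℝ} {A : SymMat n} (hf : ∀ x ∈ spectrum ℝ A.toMatrix, 0 < f x) :
    symFun f A ∈ SPD n := by
  rw [mem_SPD_iff_spectrum, spectrum_symFun]
  rintro _ ⟨x, hx, rfl⟩
  exact hf x hx

theorem symPow_mem_SPD (θ : ℝ) {A : SymMat n} (hA : A ∈ SPD n) : symPow θ A ∈ SPD n :=
  symFun_mem_SPD fun x hx => Real.rpow_pos_of_pos (mem_SPD_iff_spectrum.1 hA x hx) θ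

theorem symPow_symPow {θ μ : ℝ} (h : θ * μ = 1) {A : SymMat n} (hA : A ∈ SPD n) :
    symPow μ (symPow θ A) = A := by
  rw [symPow_eq_symFun, symPow_eq_symFun, symFun_comp]
  conv_rhs => rw [← symFun_id A]
  refine symFun_congr fun x hx => ?_
  have hx0 := mem_SPD_iff_spectrum.1 hA x hx
  simp only [Function.comp_apply, id]
  rw [← Real.rpow_mul hx0.le, h, Real.rpow_one]

theorem symFun_exp_mem_SPD (A : SymMat n) : symFun Real.exp A ∈ SPD n :=
  symFun_mem_SPD fun x _ => Real.exp_pos x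

theorem symFun_log_exp (A : SymMat n) : symFun Real.log (symFun Real.exp A) = A := by
  rw [symFun_comp]
  conv_rhs => rw [← symFun_id A]
  exact symFun_congr fun x _ => Real.log_exp x

theorem symFun_exp_log {A : SymMat n} (hA : A ∈ SPD n) :
    symFun Real.exp (symFun Real.log A) = A := by
  rw [symFun_comp]
  conv_rhs => rw [← symFun_id A]
  exact symFun_congr fun x hx => Real.exp_log (mem_SPD_iff_spectrum.1 hA x hx)

theorem symPow_eq_exp_smul_log (θ : ℝ) {A : SymMat n} (hA : A ∈ SPD n) :
    symPow θ A = symFun Real.exp (θ • symFun Real.log A) := by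
  rw [← symFun_const_mul, symFun_comp, symPow_eq_symFun]
  refine symFun_congr fun x hx => ?_
  simp only [Function.comp_apply]
  rw [Real.rpow_def_of_pos (mem_SPD_iff_spectrum.1 hA x hx), mul_comm]

end FunctionalCalculus

/-! ### Smoothness of the matrix exponential, logarithm and power -/

section Smoothness

open scoped Matrix.Norms.L2Operator Topology

variable {n : ℕ}

theorem toMatrix_symFun_exp (A : SymMat n) :
    (symFun Real.exp A).toMatrix = NormedSpace.exp A.toMatrix := by
  rw [toMatrix_symFun]
  exact CFC.real_exp_eq_normedSpace_exp A.isHermitian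

/-- The inclusion of the symmetric matrices as a continuous linear map. -/
noncomputable def SymMat.toMatrixL (n : ℕ) : SymMat n →L[ℝ] Matrix (Fin n) (Fin n) ℝ :=
  LinearMap.toContinuousLinearMap SymMat.toMatrix

theorem SymMat.toMatrixL_apply (A : SymMat n) : SymMat.toMatrixL n A = A.toMatrix := rfl

theorem contDiff_symFun_exp (n : ℕ) (m : WithTop ℕ∞) :
    ContDiff ℝ m (symFun Real.exp : SymMat n → SymMat n) := by
  obtain ⟨r, hr⟩ := (SymMat.toMatrix (n := n)).exists_leftInverse_of_injective
    (LinearMap.ker_eq_bot.2 SymMat.toMatrix_injective)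
  have h : (symFun Real.exp : SymMat n → SymMat n) =
      fun A => LinearMap.toContinuousLinearMap r (NormedSpace.exp (SymMat.toMatrixL n A)) := by
    funext A
    rw [SymMat.toMatrixL_apply, ← toMatrix_symFun_exp]
    exact (LinearMap.congr_fun hr _).symm
  have hexp : ContDiff ℝ m (NormedSpace.exp : Matrix (Fin n) (Fin n) ℝ → _) :=
    contDiff_iff_contDiffAt.2 fun x => (NormedSpace.exp_analytic (𝕂 := ℝ) x).contDiffAt
  rw [h]
  exact (LinearMap.toContinuousLinearMap r).contDiff.comp
    (hexp.comp (SymMat.toMatrixL n).contDiff)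

/-- The derivative of the exponential on symmetric matrices is injective. Differentiating
`X exp X = exp X X` shows that a vector `H` in the kernel commutes with `exp X`, hence with
`X = log (exp X)`; and in a direction commuting with `X` the derivative is `exp X H`. -/
theorem fderiv_symFun_exp_injective (X : SymMat n) :
    Function.Injective (fderiv ℝ (symFun Real.exp) X) := by
  rw [injective_iff_map_eq_zero]
  intro H hH
  set E : SymMat n → Matrix (Fin n) (Fin n) ℝ := fun Y => NormedSpace.exp Y.toMatrix with hE
  have hdiff : HasFDerivAt (symFun Real.exp) (fderiv ℝ (symFun Real.exp) X) X :=
    ((contDiff_symFun_exp n 1).differentiable one_ne_zero X).hasFDerivAt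
  have hEd : HasFDerivAt E ((SymMat.toMatrixL n).comp (fderiv ℝ (symFun Real.exp) X)) X := by
    have : E = fun Y => SymMat.toMatrixL n (symFun Real.exp Y) := by
      funext Y
      rw [SymMat.toMatrixL_apply, toMatrix_symFun_exp]
    rw [this]
    exact (SymMat.toMatrixL n).hasFDerivAt.comp X hdiff
  have hline : HasDerivAt (fun t : ℝ => X + t • H) H 0 := by
    simpa using ((hasDerivAt_id (0 : ℝ)).smul_const H).const_add X
  have hEt : HasDerivAt (fun t : ℝ => E (X + t • H)) 0 0 := by
    have h := HasFDerivAt.comp_hasDerivAt (f := fun t : ℝ => X + t • H) (0 : ℝ)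
      (by simpa using hEd) hline
    simpa [Function.comp_def, hH] using h
  have hXt : HasDerivAt (fun t : ℝ => (X + t • H).toMatrix) H.toMatrix 0 :=
    (SymMat.toMatrixL n).hasFDerivAt.comp_hasDerivAt (0 : ℝ) hline
  have hcomm : Commute (E X) H.toMatrix := by
    have h1 := hXt.mul hEt
    have h2 := hEt.mul hXt
    -- Both sides of `Y exp Y = exp Y Y` are differentiated along the line `Y = X + t H`.
    have h12 : (fun t : ℝ => (X + t • H).toMatrix) * (fun t : ℝ => E (X + t • H)) =
        (fun t : ℝ => E (X + t • H)) * (fun t : ℝ => (X + t • H).toMatrix) := by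
      funext t
      exact ((Commute.refl (X + t • H).toMatrix).exp_right).eq
    rw [h12] at h1
    have h := h1.unique h2
    simpa [eq_comm, Commute, SemiconjBy] using h
  have hcomm' : Commute X.toMatrix H.toMatrix := by
    have h : X.toMatrix = cfc Real.log (E X) := by
      conv_lhs => rw [← symFun_log_exp X, toMatrix_symFun, toMatrix_symFun_exp]
    rw [h]
    exact hcomm.cfc_real Real.log
  have h0 : E X * H.toMatrix = 0 := by
    have h3 : (fun t : ℝ => E (X + t • H)) =
        fun t : ℝ => E X * NormedSpace.exp (t • H.toMatrix) := by
      funext t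
      rw [hE]
      simp only [map_add, map_smul]
      exact Matrix.exp_add_of_commute _ _ (hcomm'.smul_right t)
    have h4 : HasDerivAt (fun t : ℝ => E X * NormedSpace.exp (t • H.toMatrix))
        (E X * H.toMatrix) 0 := by
      have := (hasDerivAt_exp_smul_const (𝕂 := ℝ) H.toMatrix (0 : ℝ)).const_mul (E X)
      simpa using this
    rw [h3] at hEt
    exact h4.unique hEt
  apply SymMat.toMatrix_injective
  rw [map_zero]
  exact (Matrix.isUnit_exp X.toMatrix).mul_right_eq_zero.1 h0

/-- The derivative of the exponential on symmetric matrices as a continuous linear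
equivalence. -/
noncomputable def fderivSymExpEquiv (X : SymMat n) : SymMat n ≃L[ℝ] SymMat n :=
  (LinearEquiv.ofInjectiveEndo (fderiv ℝ (symFun Real.exp) X : SymMat n →ₗ[ℝ] SymMat n)
    (fderiv_symFun_exp_injective X)).toContinuousLinearEquiv

theorem hasFDerivAt_symFun_exp (X : SymMat n) :
    HasFDerivAt (symFun Real.exp) (fderivSymExpEquiv X : SymMat n →L[ℝ] SymMat n) X :=
  ((contDiff_symFun_exp n 1).differentiable one_ne_zero X).hasFDerivAt

/-- Inverse function theorem for `exp` at `log A`. The local inverse `g` satisfies `exp (g Y) = Y`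
near `A`; so every `Y` near `A` is positive definite, and `log Y = log (exp (g Y)) = g Y`. -/
theorem contDiffAt_symFun_log_and_SPD_mem_nhds {A : SymMat n} (hA : A ∈ SPD n)
    {m : WithTop ℕ∞} (hm : m ≠ 0) :
    ContDiffAt ℝ m (symFun Real.log) A ∧ SPD n ∈ 𝓝 A := by
  set X := symFun Real.log A with hX
  have hXA : symFun Real.exp X = A := symFun_exp_log hA
  have hc : ContDiffAt ℝ m (symFun Real.exp) X := (contDiff_symFun_exp n m).contDiffAt
  have hd := hasFDerivAt_symFun_exp X
  have hs := hc.hasStrictFDerivAt' hd hm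
  have hright : ∀ᶠ y in 𝓝 A, symFun Real.exp (hc.localInverse hd hm y) = y := by
    rw [← hXA]
    exact hs.eventually_right_inverse
  constructor
  · have h := hc.to_localInverse hd hm
    rw [hXA] at h
    refine h.congr_of_eventuallyEq (hright.mono fun y hy => ?_)
    rw [← symFun_log_exp (hc.localInverse hd hm y), hy]
  · filter_upwards [hright] with y hy
    rw [← hy]
    exact symFun_exp_mem_SPD _

theorem isOpen_SPD (n : ℕ) : IsOpen (SPD n) :=
  isOpen_iff_mem_nhds.2 fun _ hA =>
    (contDiffAt_symFun_log_and_SPD_mem_nhds hA (m := 1) one_ne_zero).2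

theorem contDiffAt_symPow (θ : ℝ) {A : SymMat n} (hA : A ∈ SPD n) :
    ContDiffAt ℝ 2 (symPow θ) A := by
  have hlog := (contDiffAt_symFun_log_and_SPD_mem_nhds hA (m := 2) two_ne_zero).1
  have h : ContDiffAt ℝ 2 (fun B : SymMat n => symFun Real.exp (θ • symFun Real.log B)) A :=
    (contDiff_symFun_exp n 2).contDiffAt.comp A (hlog.const_smul θ)
  refine h.congr_of_eventuallyEq ?_
  filter_upwards [(isOpen_SPD n).mem_nhds hA] with B hB
  exact symPow_eq_exp_smul_log θ hB

end Smoothness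

/-! ### Geodesics, exponential map and gradient of a pullback metric -/

section PullbackMetric

open scoped Topology

variable {E F : Type*} [NormedAddCommGroup E] [NormedSpace ℝ E]
  [NormedAddCommGroup F] [InnerProductSpace ℝ F]

/-- The pullback of the Euclidean metric of `F` along `φ : E → F`. -/
noncomputable def pullbackMetric (φ : E → F) (x v w : E) : ℝ :=
  inner ℝ (fderiv ℝ φ x v) (fderiv ℝ φ x w)

/-- The derivative of `y ↦ Dφ(y)[v]` in the direction `w` is `D²φ(x)[w, v]`. -/
theorem hasFDerivAt_fderiv_apply {φ : E → F} {x : E} (hφ : ContDiffAt ℝ 2 φ x) (v : E) :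
    HasFDerivAt (fun y => fderiv ℝ φ y v) ((fderiv ℝ (fderiv ℝ φ) x).flip v) x := by
  have h : DifferentiableAt ℝ (fderiv ℝ φ) x :=
    (hφ.fderiv_right (m := 1) (by norm_num)).differentiableAt one_ne_zero
  simpa using h.hasFDerivAt.clm_apply (hasFDerivAt_const v x)

theorem fderiv_pullbackMetric {φ : E → F} {x : E} (hφ : ContDiffAt ℝ 2 φ x) (u v w : E) :
    fderiv ℝ (fun y => pullbackMetric φ y u v) x w =
      inner ℝ (fderiv ℝ (fderiv ℝ φ) x w u) (fderiv ℝ φ x v) +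
        inner ℝ (fderiv ℝ φ x u) (fderiv ℝ (fderiv ℝ φ) x w v) := by
  have h := (hasFDerivAt_fderiv_apply hφ u).inner ℝ (hasFDerivAt_fderiv_apply hφ v)
  change fderiv ℝ (fun y => inner ℝ (fderiv ℝ φ y u) (fderiv ℝ φ y v)) x w = _
  rw [h.fderiv]
  simp [fderivInnerCLM_apply, add_comm]

/-- The geodesic equation of a pullback metric says that `Dφ[b] + D²φ[v, v]`, the acceleration
of the image curve, vanishes when paired with the image of `Dφ`. -/
theorem pullbackMetric_geodesic_expression {φ : E → F} {x : E} (hφ : ContDiffAt ℝ 2 φ x)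
    (v b w : E) :
    pullbackMetric φ x b w + fderiv ℝ (fun y => pullbackMetric φ y v w) x v
      - (1 / 2) * fderiv ℝ (fun y => pullbackMetric φ y v v) x w =
    inner ℝ (fderiv ℝ φ x b + fderiv ℝ (fderiv ℝ φ) x v v) (fderiv ℝ φ x w) := by
  have hsymm : fderiv ℝ (fderiv ℝ φ) x w v = fderiv ℝ (fderiv ℝ φ) x v w :=
    (hφ.isSymmSndFDerivAt (by simp)) w v
  rw [fderiv_pullbackMetric hφ, fderiv_pullbackMetric hφ, hsymm, pullbackMetric, inner_add_left,
    real_inner_comm (fderiv ℝ φ x v) (fderiv ℝ (fderiv ℝ φ) x v w)]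
  ring

theorem derivWithin_comp_curve {φ : E → F} {c : ℝ → E} {t : ℝ} (ht : t ∈ Icc (0 : ℝ) 1)
    (hφ : ContDiffAt ℝ 2 φ (c t)) (hc : ContDiffOn ℝ 2 c (Icc 0 1)) :
    derivWithin (fun s => φ (c s)) (Icc 0 1) t =
      fderiv ℝ φ (c t) (derivWithin c (Icc 0 1) t) := by
  have h := (hφ.differentiableAt two_ne_zero).hasFDerivAt.comp_hasDerivWithinAt t
    ((hc.differentiableOn two_ne_zero t ht).hasDerivWithinAt)
  exact h.derivWithin (uniqueDiffOn_Icc zero_lt_one t ht)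

theorem derivWithin_derivWithin_comp_curve {φ : E → F} {c : ℝ → E}
    (hφ : ∀ t ∈ Icc (0 : ℝ) 1, ContDiffAt ℝ 2 φ (c t)) (hc : ContDiffOn ℝ 2 c (Icc 0 1))
    {t : ℝ} (ht : t ∈ Icc (0 : ℝ) 1) :
    derivWithin (derivWithin (fun s => φ (c s)) (Icc 0 1)) (Icc 0 1) t =
      fderiv ℝ φ (c t) (derivWithin (derivWithin c (Icc 0 1)) (Icc 0 1) t) +
        fderiv ℝ (fderiv ℝ φ) (c t) (derivWithin c (Icc 0 1) t)
          (derivWithin c (Icc 0 1) t) := by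
  have huniq := uniqueDiffOn_Icc (zero_lt_one' ℝ)
  have hcongr : EqOn (derivWithin (fun s => φ (c s)) (Icc 0 1))
      (fun s => fderiv ℝ φ (c s) (derivWithin c (Icc 0 1) s)) (Icc 0 1) :=
    fun s hs => derivWithin_comp_curve hs (hφ s hs) hc
  rw [derivWithin_congr hcongr (hcongr ht)]
  have hD : HasFDerivAt (fderiv ℝ φ) (fderiv ℝ (fderiv ℝ φ) (c t)) (c t) :=
    (((hφ t ht).fderiv_right (m := 1) (by norm_num)).differentiableAt one_ne_zero).hasFDerivAt
  have h1 := hD.comp_hasDerivWithinAt t ((hc.differentiableOn two_ne_zero t ht).hasDerivWithinAt)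
  have hc' : ContDiffOn ℝ 1 (derivWithin c (Icc 0 1)) (Icc 0 1) :=
    hc.derivWithin huniq (by norm_num)
  have h2 := (hc'.differentiableOn one_ne_zero t ht).hasDerivWithinAt
  exact ((h1.clm_apply h2).derivWithin (huniq t ht)).trans (add_comm _ _)

/-- A geodesic of the pullback metric has an affine image under `φ`, so the exponential map of
the pullback metric is the Euclidean one in the chart `φ`. -/
theorem IsRiemExp.map_eq_add {φ : E → F} {U : Set E} (hφ : ∀ x ∈ U, ContDiffAt ℝ 2 φ x)
    (hsurj : ∀ x ∈ U, Function.Surjective (fderiv ℝ φ x)) {x v y : E}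
    (h : IsRiemExp (pullbackMetric φ) U x v y) :
    y ∈ U ∧ φ y = φ x + fderiv ℝ φ x v := by
  obtain ⟨c, ⟨hc, hgeo⟩, rfl, rfl, rfl⟩ := h
  have h0 : (0 : ℝ) ∈ Icc (0 : ℝ) 1 := left_mem_Icc.2 zero_le_one
  have h1 : (1 : ℝ) ∈ Icc (0 : ℝ) 1 := right_mem_Icc.2 zero_le_one
  have huniq := uniqueDiffOn_Icc (zero_lt_one' ℝ)
  refine ⟨(hgeo 1 h1).1, ?_⟩
  have hφc : ∀ t ∈ Icc (0 : ℝ) 1, ContDiffAt ℝ 2 φ (c t) := fun t ht => hφ _ (hgeo t ht).1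
  set f : ℝ → F := fun s => φ (c s) with hf
  have hfC : ContDiffOn ℝ 2 f (Icc 0 1) := fun t ht => (hφc t ht).comp_contDiffWithinAt t (hc t ht)
  have hf' : ContDiffOn ℝ 1 (derivWithin f (Icc 0 1)) (Icc 0 1) :=
    hfC.derivWithin huniq (by norm_num)
  have hf'' : ∀ t ∈ Icc (0 : ℝ) 1,
      derivWithin (derivWithin f (Icc 0 1)) (Icc 0 1) t = 0 := by
    intro t ht
    obtain ⟨htU, hw⟩ := hgeo t ht
    rw [hf, derivWithin_derivWithin_comp_curve hφc hc ht]
    -- Pair the geodesic equation with a preimage `w` of the acceleration of `φ ∘ c`.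
    obtain ⟨w, hw'⟩ := hsurj _ htU (fderiv ℝ φ (c t)
      (derivWithin (derivWithin c (Icc 0 1)) (Icc 0 1) t) +
        fderiv ℝ (fderiv ℝ φ) (c t) (derivWithin c (Icc 0 1) t) (derivWithin c (Icc 0 1) t))
    have h := hw w
    rwa [pullbackMetric_geodesic_expression (hφc t ht), hw', inner_self_eq_zero] at h
  have hconst := constant_of_derivWithin_zero (hf'.differentiableOn one_ne_zero)
    fun t ht => hf'' t (Ico_subset_Icc_self ht)
  -- `φ ∘ c` has constant velocity, so subtracting its linear part leaves a constant.
  have hlin : ∀ t ∈ Icc (0 : ℝ) 1,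
      HasDerivWithinAt (fun s => f s - s • derivWithin f (Icc 0 1) 0) 0 (Icc 0 1) t := by
    intro t ht
    have h := (hfC.differentiableOn two_ne_zero t ht).hasDerivWithinAt.sub
      ((hasDerivWithinAt_id t (Icc (0 : ℝ) 1)).smul_const (derivWithin f (Icc 0 1) 0))
    rw [hconst t ht, one_smul, sub_self] at h
    exact h
  have h := constant_of_derivWithin_zero (fun t ht => (hlin t ht).differentiableWithinAt)
    (fun t ht => (hlin t (Ico_subset_Icc_self ht)).derivWithin
      (huniq t (Ico_subset_Icc_self ht))) 1 h1
  simp only [one_smul, zero_smul, sub_zero] at h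
  rw [sub_eq_iff_eq_add] at h
  rw [← derivWithin_comp_curve h0 (hφc 0 h0) hc]
  exact h

/-- The preimage of a segment under a chart `φ` with inverse `ψ` is a geodesic of the pullback
metric. -/
theorem isRiemExp_pullbackMetric {φ : E → F} {ψ : F → E} {U : Set E} {V : Set F}
    (hφ : ∀ x ∈ U, ContDiffAt ℝ 2 φ x)
    (hψ : ∀ z ∈ V, ContDiffAt ℝ 2 ψ z) (hψU : MapsTo ψ V U) (hφψ : ∀ z ∈ V, φ (ψ z) = z)
    (hinj : ∀ x ∈ U, Function.Injective (fderiv ℝ φ x)) (hV : Convex ℝ V) {x v : E} {z : F}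
    (hx : x ∈ U) (hxV : φ x ∈ V) (hψx : ψ (φ x) = x) (hz : z ∈ V)
    (hv : z = φ x + fderiv ℝ φ x v) :
    IsRiemExp (pullbackMetric φ) U x v (ψ z) := by
  have h0 : (0 : ℝ) ∈ Icc (0 : ℝ) 1 := left_mem_Icc.2 zero_le_one
  have huniq := uniqueDiffOn_Icc (zero_lt_one' ℝ)
  set d : F := fderiv ℝ φ x v with hd
  have hseg : ∀ t ∈ Icc (0 : ℝ) 1, φ x + t • d ∈ V := by
    intro t ht
    have h := hV.add_smul_sub_mem hxV hz ht
    rwa [hv, add_sub_cancel_left] at h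
  set c : ℝ → E := fun t => ψ (φ x + t • d) with hcdef
  have hcU : ∀ t ∈ Icc (0 : ℝ) 1, c t ∈ U := fun t ht => hψU (hseg t ht)
  have hφc : ∀ t ∈ Icc (0 : ℝ) 1, ContDiffAt ℝ 2 φ (c t) := fun t ht => hφ _ (hcU t ht)
  have hc : ContDiffOn ℝ 2 c (Icc 0 1) := fun t ht =>
    ((hψ _ (hseg t ht)).comp t (f := fun t : ℝ => φ x + t • d) (by fun_prop)).contDiffWithinAt
  have hc0 : c 0 = x := by simp [hcdef, hψx]
  have hline : EqOn (fun s => φ (c s)) (fun s => φ x + s • d) (Icc 0 1) :=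
    fun s hs => hφψ _ (hseg s hs)
  have hline' : EqOn (derivWithin (fun s => φ (c s)) (Icc 0 1)) (fun _ => d) (Icc 0 1) := by
    intro t ht
    rw [derivWithin_congr hline (hline ht)]
    have h := ((hasDerivWithinAt_id t (Icc (0 : ℝ) 1)).smul_const d).const_add (φ x)
    simpa using h.derivWithin (huniq t ht)
  refine ⟨c, ⟨hc, fun t ht => ⟨hcU t ht, ?_⟩⟩, hc0, ?_, by simp [hcdef, hv]⟩
  · intro v' b w
    rw [pullbackMetric_geodesic_expression (hφc t ht),
      ← derivWithin_derivWithin_comp_curve hφc hc ht, derivWithin_congr hline' (hline' ht)]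
    simp
  · have h := derivWithin_comp_curve h0 (hφc 0 h0) hc
    rw [hline' h0, hc0] at h
    exact hinj x hx h.symm

variable [CompleteSpace F]

/-- The Riemannian gradient of `h ∘ φ` for the pullback metric is the vector that `Dφ` sends to the
Euclidean gradient of `h`. -/
theorem isRiemGradient_pullbackMetric_iff {φ : E → F} {h : F → ℝ} {x G : E}
    (hφ : DifferentiableAt ℝ φ x) (hh : DifferentiableAt ℝ h (φ x))
    (hsurj : Function.Surjective (fderiv ℝ φ x)) :
    IsRiemGradient (pullbackMetric φ) (fun y => h (φ y)) x G ↔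
      fderiv ℝ φ x G = gradient h (φ x) := by
  have hcomp : HasFDerivAt (fun y => h (φ y)) ((fderiv ℝ h (φ x)).comp (fderiv ℝ φ x)) x :=
    hh.hasFDerivAt.comp x hφ.hasFDerivAt
  have hgrad (u : F) : fderiv ℝ h (φ x) u = inner ℝ (gradient h (φ x)) u := by
    rw [gradient, InnerProductSpace.toDual_symm_apply]
  rw [IsRiemGradient, hcomp.fderiv]
  constructor
  · rintro ⟨-, hG⟩
    refine ext_inner_right ℝ fun u => ?_
    obtain ⟨w, rfl⟩ := hsurj u
    rw [← hgrad]
    exact hG w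
  · intro hG
    refine ⟨hcomp.differentiableAt, fun w => ?_⟩
    rw [pullbackMetric, hG, ContinuousLinearMap.comp_apply, hgrad]

/-- A Riemannian gradient step for `h ∘ φ` under the pullback metric is carried by `φ` to the
Euclidean gradient step for `h`. -/
theorem IsRSGDStep.map_eq_sgdStep {φ : E → F} {U : Set E} (hφ : ∀ x ∈ U, ContDiffAt ℝ 2 φ x)
    (hsurj : ∀ x ∈ U, Function.Surjective (fderiv ℝ φ x)) {h : F → ℝ} {γ : ℝ} {x y : E}
    (hx : x ∈ U) (hh : DifferentiableAt ℝ h (φ x))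
    (hstep : IsRSGDStep (pullbackMetric φ) U γ (fun z => h (φ z)) x y) :
    y ∈ U ∧ φ y = sgdStep γ h (φ x) := by
  obtain ⟨G, hG, hexp⟩ := hstep
  rw [isRiemGradient_pullbackMetric_iff ((hφ x hx).differentiableAt two_ne_zero) hh
    (hsurj x hx)] at hG
  obtain ⟨hyU, hy⟩ := hexp.map_eq_add hφ hsurj
  refine ⟨hyU, ?_⟩
  rw [hy, map_neg, map_smul, hG, sgdStep, sub_eq_add_neg]

/-- Conversely, a Euclidean gradient step within a convex set `V` on which the chart `φ` has the
smooth inverse `ψ` comes from a Riemannian gradient step. -/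
theorem isRSGDStep_pullbackMetric {φ : E → F} {ψ : F → E} {U : Set E} {V : Set F}
    (hφ : ∀ x ∈ U, ContDiffAt ℝ 2 φ x)
    (hψ : ∀ z ∈ V, ContDiffAt ℝ 2 ψ z) (hψU : MapsTo ψ V U) (hφψ : ∀ z ∈ V, φ (ψ z) = z)
    (hbij : ∀ x ∈ U, Function.Bijective (fderiv ℝ φ x)) (hV : Convex ℝ V)
    {h : F → ℝ} {γ : ℝ} {p : F} (hp : p ∈ V) (hh : DifferentiableAt ℝ h p)
    (hstep : sgdStep γ h p ∈ V) :
    IsRSGDStep (pullbackMetric φ) U γ (fun z => h (φ z)) (ψ p) (ψ (sgdStep γ h p)) := by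
  have hpU : ψ p ∈ U := hψU hp
  have hφp := hφψ p hp
  obtain ⟨G, hG⟩ := (hbij _ hpU).2 (gradient h p)
  refine ⟨G, ?_, ?_⟩
  · rw [isRiemGradient_pullbackMetric_iff ((hφ _ hpU).differentiableAt two_ne_zero)
      (by rwa [hφp]) (hbij _ hpU).2, hφp, hG]
  · refine isRiemExp_pullbackMetric hφ hψ hψU hφψ (fun x hx => (hbij x hx).1) hV hpU
      (by rwa [hφp]) (by rw [hφp]) hstep ?_
    rw [map_neg, map_smul, hG, hφp, sgdStep, sub_eq_add_neg]

end PullbackMetric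

/-! ### The chart `φ_θ` of the Power-Euclidean metric -/

section ScaledPow

variable {n : ℕ} {θ : ℝ}

/-- The inverse of `φ_θ` on the positive definite matrices, `Z ↦ (θ Z) ^ (1 / θ)`. -/
noncomputable def invScaledPow (θ : ℝ) (Z : SymMat n) : SymMat n :=
  symPow θ⁻¹ (θ • Z)

theorem pemMetric_eq_pullbackMetric (θ : ℝ) :
    pemMetric (n := n) θ = pullbackMetric (scaledPow θ) := by
  funext P V W
  have h : fderiv ℝ (scaledPow (n := n) θ) P = (1 / θ) • fderiv ℝ (symPow θ) P :=
    congrFun (fderiv_const_smul_field (f := symPow θ) (1 / θ)) P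
  rw [pullbackMetric, h, pemMetric]
  simp only [smul_apply, real_inner_smul_left, real_inner_smul_right]
  ring

theorem scaledPow_mem_SPD (hθ : 0 < θ) {S : SymMat n} (hS : S ∈ SPD n) :
    scaledPow θ S ∈ SPD n :=
  smul_mem_SPD (one_div_pos.2 hθ) (symPow_mem_SPD θ hS)

theorem invScaledPow_mem_SPD (hθ : 0 < θ) {Z : SymMat n} (hZ : Z ∈ SPD n) :
    invScaledPow θ Z ∈ SPD n :=
  symPow_mem_SPD θ⁻¹ (smul_mem_SPD hθ hZ)

theorem invScaledPow_scaledPow (hθ : 0 < θ) {S : SymMat n} (hS : S ∈ SPD n) :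
    invScaledPow θ (scaledPow θ S) = S := by
  rw [invScaledPow, scaledPow, smul_smul, mul_one_div_cancel hθ.ne', one_smul,
    symPow_symPow (mul_inv_cancel₀ hθ.ne') hS]

theorem scaledPow_invScaledPow (hθ : 0 < θ) {Z : SymMat n} (hZ : Z ∈ SPD n) :
    scaledPow θ (invScaledPow θ Z) = Z := by
  rw [invScaledPow, scaledPow, symPow_symPow (inv_mul_cancel₀ hθ.ne') (smul_mem_SPD hθ hZ),
    smul_smul, one_div_mul_cancel hθ.ne', one_smul]

theorem bijOn_scaledPow (hθ : 0 < θ) : BijOn (scaledPow θ) (SPD n) (SPD n) :=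
  InvOn.bijOn ⟨fun _ hS => invScaledPow_scaledPow hθ hS, fun _ hZ => scaledPow_invScaledPow hθ hZ⟩
    (fun _ hS => scaledPow_mem_SPD hθ hS) fun _ hZ => invScaledPow_mem_SPD hθ hZ

theorem contDiffAt_scaledPow (θ : ℝ) {S : SymMat n} (hS : S ∈ SPD n) :
    ContDiffAt ℝ 2 (scaledPow θ) S :=
  (contDiffAt_symPow θ hS).const_smul (1 / θ)

theorem contDiffAt_invScaledPow (hθ : 0 < θ) {Z : SymMat n} (hZ : Z ∈ SPD n) :
    ContDiffAt ℝ 2 (invScaledPow θ) Z :=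
  (contDiffAt_symPow θ⁻¹ (smul_mem_SPD hθ hZ)).comp Z (contDiffAt_id.const_smul θ)

/-- The derivative of `φ_θ` is bijective: it is injective because `φ_θ` has a differentiable left
inverse, and the space of symmetric matrices has finite dimension. -/
theorem bijective_fderiv_scaledPow (hθ : 0 < θ) {S : SymMat n} (hS : S ∈ SPD n) :
    Function.Bijective (fderiv ℝ (scaledPow θ) S) := by
  have hφ := ((contDiffAt_scaledPow θ hS).differentiableAt two_ne_zero).hasFDerivAt
  have hψ := ((contDiffAt_invScaledPow hθ
    (scaledPow_mem_SPD hθ hS)).differentiableAt two_ne_zero).hasFDerivAt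
  have hid : HasFDerivAt (invScaledPow θ ∘ scaledPow θ) (ContinuousLinearMap.id ℝ (SymMat n)) S := by
    refine (hasFDerivAt_id S).congr_of_eventuallyEq ?_
    filter_upwards [(isOpen_SPD n).mem_nhds hS] with X hX
    exact invScaledPow_scaledPow hθ hX
  have hcomp := (hψ.comp S hφ).unique hid
  have hinj : Function.Injective (fderiv ℝ (scaledPow θ) S) :=
    Function.LeftInverse.injective fun v => DFunLike.congr_fun hcomp v
  exact ⟨hinj, LinearMap.injective_iff_surjective.1 hinj⟩

end ScaledPow

/-! ### The two regressions and their losses -/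

section Regression

theorem softmaxProb_pos {C : ℕ} (z : Fin C → ℝ) (k : Fin C) : 0 < softmaxProb z k :=
  div_pos (Real.exp_pos _) (Finset.sum_pos (fun _ _ => Real.exp_pos _) ⟨k, Finset.mem_univ k⟩)

variable {n C : ℕ}

theorem pemMLR_eq_euclMLR (θ : ℝ) (P A : Fin C → SymMat n) :
    pemMLR θ P A = fun S => euclMLR (fun k => scaledPow θ (P k)) A (scaledPow θ S) := by
  funext S
  rw [pemMLR, euclMLR]
  congr 1
  funext k
  rw [scaledPow, scaledPow, ← smul_sub, real_inner_smul_right, real_inner_comm]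

theorem pemMLR_update_eq_euclMLR (θ : ℝ) (P A : Fin C → SymMat n) (k : Fin C) (X : SymMat n) :
    pemMLR θ (Function.update P k X) A = fun S =>
      euclMLR (Function.update (fun j => scaledPow θ (P j)) k (scaledPow θ X)) A
        (scaledPow θ S) := by
  rw [pemMLR_eq_euclMLR]
  funext S
  congr 1
  funext j
  exact Function.apply_update (fun _ => scaledPow θ) P k X j

theorem differentiable_softmaxProb {E : Type*} [NormedAddCommGroup E] [NormedSpace ℝ E]
    {z : E → Fin C → ℝ} (hz : ∀ j, Differentiable ℝ fun X => z X j) (k : Fin C) :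
    Differentiable ℝ fun X => softmaxProb (z X) k := by
  have hsum : Differentiable ℝ fun X => ∑ j, Real.exp (z X j) :=
    Differentiable.fun_sum fun j _ => (hz j).exp
  simp only [softmaxProb, div_eq_mul_inv]
  exact (hz k).exp.fun_mul <| hsum.fun_inv fun X =>
    (Finset.sum_pos (fun _ _ => Real.exp_pos _) ⟨k, Finset.mem_univ k⟩).ne'

theorem isOpen_setOf_forall_pos (m C : ℕ) :
    IsOpen {q : Fin m → Fin C → ℝ | ∀ i k, 0 < q i k} := by
  simp only [ofPred_forall]
  refine isOpen_iInter_of_finite fun i => isOpen_iInter_of_finite fun k => ?_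
  exact isOpen_lt continuous_const (by fun_prop)

theorem SPDBatch.differentiable_eval_euclMLR_update (B : SPDBatch n C) (φ : SymMat n → SymMat n)
    (p a : Fin C → SymMat n) (k : Fin C) :
    Differentiable ℝ fun X => B.eval fun S => euclMLR (Function.update p k X) a (φ S) := by
  intro X
  have hq : Differentiable ℝ fun (Y : SymMat n) (i : Fin B.size) =>
      euclMLR (Function.update p k Y) a (φ (B.input i)) := by
    refine differentiable_pi.2 fun i => differentiable_pi.2 fun l => ?_
    refine differentiable_softmaxProb (fun j => ?_) l
    have hu : Differentiable ℝ fun Y : SymMat n => Function.update p k Y j := by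
      by_cases hj : j = k
      · subst hj
        simp
      · simp [Function.update_of_ne hj]
    exact (differentiable_const _).inner ℝ ((differentiable_const _).sub hu)
  have hloss := B.loss_diff.differentiableAt ((isOpen_setOf_forall_pos B.size C).mem_nhds
    (x := fun i => euclMLR (Function.update p k X) a (φ (B.input i)))
    fun i l => softmaxProb_pos _ l)
  exact hloss.comp X (hq X)

/-- A step of the SPD regression in `P k` is carried by `φ_θ` to a step of the Euclidean one. -/
theorem scaledPow_step {θ : ℝ} (hθ : 0 < θ) {γ : ℝ} {B : SPDBatch n C} {P A : Fin C → SymMat n}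
    {k : Fin C} {Q : SymMat n} (hP : P k ∈ SPD n)
    (h : IsRSGDStep (pemMetric θ) (SPD n) γ
      (fun X => B.eval (pemMLR θ (Function.update P k X) A)) (P k) Q) :
    Q ∈ SPD n ∧ scaledPow θ Q = sgdStep γ (fun X => B.eval fun S =>
      euclMLR (Function.update (fun j => scaledPow θ (P j)) k X) A (scaledPow θ S))
        (scaledPow θ (P k)) := by
  rw [pemMetric_eq_pullbackMetric] at h
  simp only [pemMLR_update_eq_euclMLR] at h
  exact IsRSGDStep.map_eq_sgdStep (h := fun X => B.eval fun S =>
      euclMLR (Function.update (fun j => scaledPow θ (P j)) k X) A (scaledPow θ S))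
    (fun S hS => contDiffAt_scaledPow θ hS)
    (fun S hS => (bijective_fderiv_scaledPow hθ hS).2) hP
    (B.differentiable_eval_euclMLR_update _ _ _ _ _) h

/-- A step of the Euclidean regression in `p k` that stays positive definite comes from a step of
the SPD regression. -/
theorem isRSGDStep_invScaledPow {θ : ℝ} (hθ : 0 < θ) {γ : ℝ} {B : SPDBatch n C}
    {p a : Fin C → SymMat n} {k : Fin C} {q : SymMat n} (hp : ∀ j, p j ∈ SPD n) (hq : q ∈ SPD n)
    (h : q = sgdStep γ (fun X => B.eval fun S =>
      euclMLR (Function.update p k X) a (scaledPow θ S)) (p k)) :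
    IsRSGDStep (pemMetric θ) (SPD n) γ
      (fun X => B.eval (pemMLR θ (Function.update (fun j => invScaledPow θ (p j)) k X) a))
      (invScaledPow θ (p k)) (invScaledPow θ q) := by
  simp only [pemMetric_eq_pullbackMetric, pemMLR_update_eq_euclMLR,
    scaledPow_invScaledPow hθ (hp _)]
  rw [h]
  refine isRSGDStep_pullbackMetric (V := SPD n) (fun S hS => contDiffAt_scaledPow θ hS)
    (fun Z hZ => contDiffAt_invScaledPow hθ hZ) (fun Z hZ => invScaledPow_mem_SPD hθ hZ)
    (fun Z hZ => scaledPow_invScaledPow hθ hZ) (fun S hS => bijective_fderiv_scaledPow hθ hS)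
    (convex_SPD n) (h := fun X => B.eval fun S =>
      euclMLR (Function.update p k X) a (scaledPow θ S)) (hp k)
    (B.differentiable_eval_euclMLR_update _ _ _ _ _) ?_
  rwa [← h]

end Regression

/-! ### Equivalence of the training runs -/

theorem mainTheorem1 {n C : ℕ} (θ : ℝ) (hθ : 0 < θ) (γ η : ℕ → ℝ)
    (B : ℕ → SPDBatch n C) (T : ℕ∞) :
    Set.BijOn (scaledPow θ) (SPD n) (SPD n) ∧
    (∀ P A p a : ℕ → Fin C → SymMat n,
      IsPEMTraining θ γ η B T P A →
      IsEuclTraining (scaledPow θ) γ η B T p a →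
      (∀ k, p 0 k = scaledPow θ (P 0 k)) → (∀ k, a 0 k = A 0 k) →
      ∀ t : ℕ, (t : ℕ∞) ≤ T →
        (∀ k, P t k ∈ SPD n ∧ p t k = scaledPow θ (P t k) ∧ a t k = A t k) ∧
        ∀ S ∈ SPD n, pemMLR θ (P t) (A t) S = euclMLR (p t) (a t) (scaledPow θ S)) ∧
    (∀ p a : ℕ → Fin C → SymMat n,
      IsEuclTraining (scaledPow θ) γ η B T p a →
      (∀ t : ℕ, (t : ℕ∞) ≤ T → ∀ k, p t k ∈ SPD n) →
      ∃ P A : ℕ → Fin C → SymMat n,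
        IsPEMTraining θ γ η B T P A ∧
        ∀ t : ℕ, (t : ℕ∞) ≤ T → ∀ k, p t k = scaledPow θ (P t k) ∧ a t k = A t k) := by
  refine ⟨bijOn_scaledPow hθ, ?_, ?_⟩
  · intro P A p a hP hp hp0 ha0 t ht
    have hparam : ∀ k, P t k ∈ SPD n ∧ p t k = scaledPow θ (P t k) ∧ a t k = A t k := by
      induction t with
      | zero => exact fun k => ⟨hP.1 k, hp0 k, ha0 k⟩
      | succ t ih =>
        have htT : (t : ℕ∞) < T := lt_of_lt_of_le (by exact_mod_cast t.lt_succ_self) ht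
        have ih := ih htT.le
        have hpt : p t = fun j => scaledPow θ (P t j) := funext fun j => (ih j).2.1
        have hat : a t = A t := funext fun j => (ih j).2.2
        intro k
        obtain ⟨hPk, hAk⟩ := hP.2 t htT k
        obtain ⟨hpk, hak⟩ := hp t htT k
        rw [hpt, hat] at hpk hak
        obtain ⟨hmem, hstep⟩ := scaledPow_step hθ (ih k).1 hPk
        refine ⟨hmem, hpk.trans hstep.symm, ?_⟩
        rw [hak, hAk]
        simp only [pemMLR_eq_euclMLR]
    refine ⟨hparam, fun S _ => ?_⟩
    rw [pemMLR_eq_euclMLR, funext fun k => (hparam k).2.1, funext fun k => (hparam k).2.2]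
  · intro p a hp hpos
    refine ⟨fun t k => invScaledPow θ (p t k), a, ⟨fun k => ?_, fun t ht k => ⟨?_, ?_⟩⟩,
      fun t ht k => ⟨(scaledPow_invScaledPow hθ (hpos t ht k)).symm, rfl⟩⟩
    · exact invScaledPow_mem_SPD hθ (hpos 0 (by simp) k)
    · have ht' : ((t + 1 : ℕ) : ℕ∞) ≤ T := by
        exact_mod_cast Order.add_one_le_of_lt ht
      exact isRSGDStep_invScaledPow hθ (hpos t ht.le) (hpos _ ht' k) (hp t ht k).1
    · rw [(hp t ht k).2]
      simp only [pemMLR_eq_euclMLR, scaledPow_invScaledPow hθ (hpos t ht.le _)]
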